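/- **Setting.** An episodic MDP has a finite state space $\mathcal S$ with $S$ states, an initial state $s_0$, a finite action space $\mathcal A$ with $A\ge 1$ actions, a horizon $H\ge 1$ and unknown transition dynamics $P=\{P_h\}_{h=0}^{H-1}$. For a Markov policy $\pi$ and a reward function $r_h:\mathcal S\times\mathcal A\to[0,1]$, let $V^\pi_{P,r}=\mathbb E_{P,\pi}\big[\sum_{h=0}^{H-1}r_h(s_h,a_h)\big]$, $V^\star_{P,r}=\max_\pi V^\pi_{P,r}$, and let $q_h(s\mid\pi,P)=\Pr[s_h=s\mid P,\pi]$. Let $s_{\rm sink}$ be an additional absorbing state with reward $0$. **Algorithm MARFE** (input: the number of agents $m$ and a threshold $\beta>0$). For each of the $H$ learning phases $i=0,\dots,H-1$, using the dynamics $\widehat P_0,\dots,\widehat P_{i-1}$ learned so far: 1. For every $s\in\mathcal S$ choose a deterministic policy $\widehat\pi^{i,s}\in\arg\max_\pi q_i(s\mid\pi,\{\widehat P_k\}_{k<i})$, and put $\widehat{\mathcal S}_i=\{s\in\mathcal S: q_i(s\mid\widehat\pi^{i,s},\{\widehat P_k\}_{k<i})\ge\beta\}$. 2. Partition the $m$ agents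 into groups $G^{i,s,a}$, $(s,a)\in\widehat{\mathcal S}_i\times\mathcal A$, of equal sizes up to rounding. All agents independently run one episode under $P$; an agent of $G^{i,s,a}$ follows $\widehat\pi^{i,s}$, except that it takes action $a$ in state $s$ at time $i$. 3. Let $N_i(s,a,s')$ be the number of agents that are in $s$ at time $i$, take action $a$ and move to $s'$, and let $N_i(s,a)=\sum_{s'}N_i(s,a,s')$. Set $\widehat P_i(s'\mid s,a)=N_i(s,a,s')/N_i(s,a)$ for $s\in\widehat{\mathcal S}_i$ (if $N_i(s,a)=0$, move to $s_{\rm sink}$), and let every $s\notin\widehat{\mathcal S}_i$ move to $s_{\rm sink}$ with probability $1$. The output is $\widehat P=\{\widehat P_i\}_{i=0}^{H-1}$. Ties in step 1 and the partitions in step 2 may be chosen arbitrarily, depending on the data of the earlier phases; if $\widehat{\mathcal S}_i=\emptyset$ then the agents may run anything in phase $i$. **Theorem.** There is an absolute constant $C>0$ such that the following holds for all $S,A,H,s_0,P$ as above and all $\varepsilon,\delta\in(0,1)$. Run MARFE for exactly $H$ learning phases with $\beta=\varepsilon/(2H^2S)$ and any number $$m\ \ge\ C\,\frac{S^5H^6A\,\big(\log(SHA/\delta)+S\big)}{\varepsilon^2}$$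 of agents per phase. Then, with probability at least $1-\delta$, for every reward function $r$ and every policy $\widehat\pi_r\in\arg\max_\pi V^\pi_{\widehat P,r}$, $$V^\star_{P,r}-V^{\widehat\pi_r}_{P,r}\le\varepsilon .$$ Policies may be deterministic or randomized here. -/

import Mathlib

open scoped ENNReal

noncomputable section

namespace MARFE

/-! ### Episodic Markov decision processes -/

section MDP

/-- Time-inhomogeneous transition dynamics: `P h x a` is the law of the state at time `h + 1` when
action `a` is taken in state `x` at time `h`. In an episode of length `H` only `h < H` is used. -/
abbrev Dynamics (X A : Type*) := ℕ → X → A → PMF X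

/-- A (possibly randomized) Markov policy: `π h x` is the law of the action at time `h` in `x`. -/
abbrev Policy (X A : Type*) := ℕ → X → PMF A

/-- A deterministic Markov policy. -/
abbrev DetPolicy (X A : Type*) := ℕ → X → A

/-- A trajectory of `n` steps, stored as its transitions `(s_h, a_h, s_{h+1})` for `h < n`. -/
abbrev Trajectory (X A : Type*) (n : ℕ) := Fin n → X × A × X

/-- A deterministic policy regarded as a randomized one. -/
def det {X A : Type*} (π : DetPolicy X A) : Policy X A := fun h x => PMF.pure (π h x)

/-- The state `s_n` in which an `n`-step trajectory started in `s₀` ends. -/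
def endState {X A : Type*} (s₀ : X) : {n : ℕ} → Trajectory X A n → X
  | 0, _ => s₀
  | n + 1, τ => (τ (Fin.last n)).2.2

/-- The law of the first `n` steps of an episode that starts in `s₀` and follows `π` under `P`:
given the first `n` steps, the action is drawn from `π n s_n` and then `s_{n+1}` from
`P n s_n a_n`. -/
def episode {X A : Type*} (P : Dynamics X A) (π : Policy X A) (s₀ : X) :
    (n : ℕ) → PMF (Trajectory X A n)
  | 0 => PMF.pure Fin.elim0
  | n + 1 =>
    (episode P π s₀ n).bind fun τ =>
      (π n (endState s₀ τ)).bind fun a =>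
        (P n (endState s₀ τ) a).map fun x' =>
          Fin.snoc (α := fun _ => X × A × X) τ (endState s₀ τ, a, x')

/-- The occupancy measure `q_n(x | π, P)`: the probability that `s_n = x`. It depends only on
`P h` and `π h` for `h < n`. -/
def occupancy {X A : Type*} (P : Dynamics X A) (π : Policy X A) (s₀ : X) (n : ℕ) (x : X) : ℝ :=
  ((episode P π s₀ n).map (endState s₀) x).toReal

/-- The value `E[∑_{h < H} r_h(s_h, a_h)]` of `π` under the dynamics `P` and the reward `r`. -/
def value {X A : Type*} [Fintype X] [Fintype A] (P : Dynamics X A) (r : ℕ → X → A → ℝ) (s₀ : X)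
    (H : ℕ) (π : Policy X A) : ℝ :=
  ∑ τ : Trajectory X A H,
    (episode P π s₀ H τ).toReal * ∑ h : Fin H, r h (τ h).1 (τ h).2.1

end MDP

/-! ### The additional sink state -/

section Sink

variable {S A : Type*}

/-- A policy on `S`, used on `S ∪ {sink} = Option S`. The action in the sink `none` is irrelevant:
the sink will be absorbing and carry no reward. -/
def extendPolicy [Nonempty A] (π : Policy S A) : Policy (Option S) A
  | h, some s => π h s
  | _, none => PMF.pure (Classical.arbitrary A)

/-- A reward on `S`, extended by zero to the sink. -/
def extendReward (r : ℕ → S → A → ℝ) : ℕ → Option S → A → ℝ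
  | h, some s, a => r h s a
  | _, none, _ => 0

/-- The value of a policy on `S` under dynamics on `S ∪ {sink}` started in `s₀ ∈ S`. -/
def sinkValue [Fintype S] [Fintype A] [Nonempty A] (Q : Dynamics (Option S) A)
    (r : ℕ → S → A → ℝ) (s₀ : S) (H : ℕ) (π : Policy S A) : ℝ :=
  value Q (extendReward r) (some s₀) H (extendPolicy π)

/-- The probability that a policy on `S` reaches `s ∈ S` at time `n` under dynamics on
`S ∪ {sink}`. -/
def sinkOccupancy [Nonempty A] (Q : Dynamics (Option S) A) (π : Policy S A) (s₀ : S) (n : ℕ)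
    (s : S) : ℝ :=
  occupancy Q (extendPolicy π) (some s₀) n (some s)

end Sink

/-! ### Independent agents -/

/-- The joint law of independent random variables with laws `p j`. -/
def independent {ι Y : Type*} [Fintype ι] [DecidableEq ι] [Fintype Y] (p : ι → PMF Y) :
    PMF (ι → Y) :=
  PMF.ofFintype (fun y => ∏ j, p j (y j)) (by
    have h : ∀ j, ∑ y, p j y = 1 := fun j => (tsum_fintype (p j)).symm.trans (p j).tsum_coe
    rw [← Fintype.piFinset_univ, ← Finset.prod_univ_sum]
    exact Finset.prod_eq_one fun j _ => h j)

/-! ### The algorithm -/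

section Algorithm

/-- The data of one learning phase: the length-`H` trajectory of each of the `m` agents. -/
abbrev PhaseData (S A : Type*) (m H : ℕ) := Fin m → Trajectory S A H

/-- The data of the completed learning phases, the latest phase first. So phase `T.length` is the
next one to be run. -/
abbrev Transcript (S A : Type*) (m H : ℕ) := List (PhaseData S A m H)

variable {S A : Type*} {m H : ℕ}

/-- `N_i(s, a, s')`: the number of agents that are in `s` at time `i`, take action `a` and move
to `s'`. -/
def count (d : PhaseData S A m H) (i : ℕ) (s : S) (a : A) (s' : S) : ℕ :=
  Nat.card {j : Fin m // ∃ t : Fin H, (t : ℕ) = i ∧ d j t = (s, a, s')}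

open Classical in
/-- The estimate of the transitions at time `i`. From an active state `s`, the next state is `s'`
with probability `N_i(s, a, s') / N_i(s, a)`, where `N_i(s, a) = ∑ s', N_i(s, a, s')`. From any
other state, the next state is the sink. (If an active pair `(s, a)` was never visited, so that the
quotient is `0 / 0`, the next state is the sink too.) -/
def empirical [Fintype S] (active : Set S) (d : PhaseData S A m H) (i : ℕ) :
    Option S → A → PMF (Option S)
  | none, _ => PMF.pure none
  | some s, a =>
    if h : s ∈ active ∧ ∑' s', (count d i s a s' : ℝ≥0∞) ≠ 0 then
      (PMF.normalize (fun s' => (count d i s a s' : ℝ≥0∞)) h.2 (by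
        rw [tsum_fintype]
        exact ENNReal.sum_ne_top.2 fun s' _ => ENNReal.natCast_ne_top _)).map some
    else PMF.pure none

/-- The choices that the algorithm leaves open, made after the phases recorded in a transcript:
`plan T s` is the policy for reaching `s` at time `T.length`, and `assign T j = (s, a)` puts
agent `j` into the group of the pair `(s, a)`. -/
structure Choices (S A : Type*) (m H : ℕ) where
  plan : Transcript S A m H → S → DetPolicy S A
  assign : Transcript S A m H → Fin m → S × A

/-- The active states of phase `i`: those which their own plan reaches at time `i` with probability
at least `β` under the dynamics `Q`. -/
def activeStates [Nonempty A] (Q : Dynamics (Option S) A) (plan : S → DetPolicy S A) (s₀ : S)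
    (β : ℝ) (i : ℕ) : Set S :=
  {s | β ≤ sinkOccupancy Q (det (plan s)) s₀ i s}

/-- The learned dynamics after the phases recorded in a transcript. Phase `i` sets the transitions
at time `i`. (Times that are not yet learned lead to the sink and are never used.) -/
def learned [Fintype S] [Nonempty A] (c : Choices S A m H) (s₀ : S) (β : ℝ) :
    Transcript S A m H → Dynamics (Option S) A
  | [] => fun _ _ _ => PMF.pure none
  | d :: T =>
    Function.update (learned c s₀ β T) T.length
      (empirical (activeStates (learned c s₀ β T) (c.plan T) s₀ β T.length) d T.length)

/-- The active states of the phase that follows a transcript. -/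
def active [Fintype S] [Nonempty A] (c : Choices S A m H) (s₀ : S) (β : ℝ)
    (T : Transcript S A m H) : Set S :=
  activeStates (learned c s₀ β T) (c.plan T) s₀ β T.length

/-- The choices follow the algorithm: each plan maximizes the probability of reaching its state at
the current time under the dynamics learned so far, and the agents are partitioned into groups
indexed by the pairs of an active state and an action, of equal sizes up to rounding. (If there is
no active state then the agents may do anything.) -/
structure Choices.Valid [Fintype S] [Nonempty A] (c : Choices S A m H) (s₀ : S) (β : ℝ) :
    Prop where
  plan_max : ∀ (T : Transcript S A m H) (s : S) (π : DetPolicy S A),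
    sinkOccupancy (learned c s₀ β T) (det π) s₀ T.length s ≤
      sinkOccupancy (learned c s₀ β T) (det (c.plan T s)) s₀ T.length s
  assign_mem : ∀ T : Transcript S A m H, (active c s₀ β T).Nonempty →
    ∀ j, (c.assign T j).1 ∈ active c s₀ β T
  assign_equal : ∀ T : Transcript S A m H,
    ∀ s ∈ active c s₀ β T, ∀ s' ∈ active c s₀ β T, ∀ a a' : A,
      Nat.card {j // c.assign T j = (s, a)} ≤ Nat.card {j // c.assign T j = (s', a')} + 1

open Classical in
/-- The policy run in phase `i` by an agent in the group of `(s, a)`: follow the plan for `s`, but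
take action `a` in state `s` at time `i`. -/
def groupPolicy (plan : S → DetPolicy S A) (i : ℕ) (g : S × A) : DetPolicy S A :=
  fun h x => if h = i ∧ x = g.1 then g.2 else plan g.1 h x

/-- The law of the data of the phase that follows a transcript: all agents run one episode each,
independently, under the true dynamics `P`. -/
def phase [Fintype S] [Fintype A] (P : Dynamics S A) (c : Choices S A m H) (s₀ : S)
    (T : Transcript S A m H) : PMF (PhaseData S A m H) :=
  independent fun j =>
    episode P (det (groupPolicy (c.plan T) T.length (c.assign T j))) s₀ H

/-- The law of the transcript after `n` learning phases. -/
def run [Fintype S] [Fintype A] (P : Dynamics S A) (c : Choices S A m H) (s₀ : S) :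
    ℕ → PMF (Transcript S A m H)
  | 0 => PMF.pure []
  | n + 1 => (run P c s₀ n).bind fun T => (phase P c s₀ T).map fun d => d :: T

/-- The law of the dynamics that the algorithm outputs after exactly `H` learning phases with `m`
agents each and reachability threshold `β`. -/
def output [Fintype S] [Fintype A] [Nonempty A] (P : Dynamics S A) (c : Choices S A m H) (s₀ : S)
    (β : ℝ) : PMF (Dynamics (Option S) A) :=
  (run P c s₀ H).map (learned c s₀ β)

end Algorithm

end MARFE

end

/-! Fix a phase and an active pair `(s, a)`. Let `p` be the true probability that the plan for `s`
reaches `s`, `k` the group size and `e` the `L¹` error of the estimate. About `k * p` visits occur,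
so `e ^ 2 * p` is at most of order `S / k` up to logarithms, however small `p` is. Control of this
product suffices for planning. Let `u` be the learned occupancy of `s` under any policy, and `û ≥ β`
that under the plan, which is optimal for the learned dynamics. If the learned dynamics overestimate
occupancies by at most `β / 2`, then `û ≤ 2 * p`, hence `(u * e) ^ 2 ≤ û * e ^ 2 ≤ 2 * p * e ^ 2 ≤ γ
^ 2` (`IsAccurate.weighted_error_le`).

The overestimation hypothesis propagates in time: inactive states lose their mass to the sink, so
only active ones create excess, at most `S * γ` per step, and `H * S * γ ≤ β / 2`. Underestimation
costs a further `β` per inactive state and step. Summing over the horizon compares values for all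
policies and rewards at once (`IsAccurate.value_sub_value_le`).

For the concentration, one exponential moment handles the random number of visits together with the
deviation (`expect_exp_deviation_le`). Union bounds over sets of next states, pairs and phases
produce the terms `S` and `log (S * H * A / δ)`. -/

namespace MARFE

/-! ### Expectations over finite types -/

/-- The expectation of a real function on a finite type. -/
noncomputable def expect {Y : Type*} [Fintype Y] (p : PMF Y) (f : Y → ℝ) : ℝ :=
  ∑ y, (p y).toReal * f y

section Expect

variable {X Y : Type*} [Fintype X] [Fintype Y]

theorem sum_toReal (p : PMF Y) : ∑ y, (p y).toReal = 1 := by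
  have h : ∑ y, p y = 1 := (tsum_fintype p).symm.trans p.tsum_coe
  rw [← ENNReal.toReal_sum fun y _ => p.apply_ne_top y, h, ENNReal.toReal_one]

theorem expect_const (p : PMF Y) (c : ℝ) : expect p (fun _ => c) = c := by
  rw [expect, ← Finset.sum_mul, sum_toReal, one_mul]

theorem expect_mono (p : PMF Y) {f g : Y → ℝ} (h : ∀ y, f y ≤ g y) : expect p f ≤ expect p g :=
  Finset.sum_le_sum fun y _ => mul_le_mul_of_nonneg_left (h y) ENNReal.toReal_nonneg

theorem expect_nonneg (p : PMF Y) {f : Y → ℝ} (h : ∀ y, 0 ≤ f y) : 0 ≤ expect p f :=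
  Finset.sum_nonneg fun y _ => mul_nonneg ENNReal.toReal_nonneg (h y)

theorem expect_add (p : PMF Y) (f g : Y → ℝ) :
    expect p (fun y => f y + g y) = expect p f + expect p g := by
  simp only [expect, mul_add, Finset.sum_add_distrib]

theorem expect_sub (p : PMF Y) (f g : Y → ℝ) :
    expect p (fun y => f y - g y) = expect p f - expect p g := by
  simp only [expect, mul_sub, Finset.sum_sub_distrib]

theorem expect_mul_left (p : PMF Y) (c : ℝ) (f : Y → ℝ) :
    expect p (fun y => c * f y) = c * expect p f := by
  rw [expect, expect, Finset.mul_sum]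
  exact Finset.sum_congr rfl fun y _ => by ring

theorem expect_sum {ι : Type*} (p : PMF Y) (s : Finset ι) (f : ι → Y → ℝ) :
    expect p (fun y => ∑ i ∈ s, f i y) = ∑ i ∈ s, expect p (f i) := by
  simp only [expect, Finset.mul_sum]
  exact Finset.sum_comm

theorem expect_pure (y : Y) (f : Y → ℝ) : expect (PMF.pure y) f = f y := by
  classical
  rw [expect, Finset.sum_eq_single y]
  · simp
  · intro z _ hz
    simp [PMF.pure_apply, hz]
  · simp

theorem expect_bind (p : PMF X) (q : X → PMF Y) (f : Y → ℝ) :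
    expect (p.bind q) f = expect p fun x => expect (q x) f := by
  have h : ∀ y, (p.bind q y).toReal = ∑ x, (p x).toReal * (q x y).toReal := by
    intro y
    rw [PMF.bind_apply, tsum_fintype, ENNReal.toReal_sum]
    · simp only [ENNReal.toReal_mul]
    · exact fun x _ => ENNReal.mul_ne_top (p.apply_ne_top x) ((q x).apply_ne_top y)
  simp only [expect, h, Finset.sum_mul, Finset.mul_sum]
  rw [Finset.sum_comm]
  exact Finset.sum_congr rfl fun x _ => Finset.sum_congr rfl fun y _ => by ring

theorem expect_map (p : PMF X) (g : X → Y) (f : Y → ℝ) :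
    expect (p.map g) f = expect p fun x => f (g x) := by
  rw [← PMF.bind_pure_comp, expect_bind]
  simp only [Function.comp, expect_pure]

theorem expect_le_of_le (p : PMF Y) {f : Y → ℝ} {c : ℝ} (h : ∀ y, f y ≤ c) : expect p f ≤ c :=
  (expect_mono p h).trans_eq (expect_const p c)

theorem expect_indicator [DecidableEq Y] (p : PMF Y) (y : Y) :
    expect p (fun z => if z = y then 1 else 0) = (p y).toReal := by
  simp [expect]

/-- The clause on point masses matters at the sink, where an extended policy has a prescribed
action: the improved policy must again be the extension of a policy on `S`. -/
theorem exists_action_ge_expect {A : Type*} [Fintype A] [Nonempty A] (p : PMF A) (g : A → ℝ) :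
    ∃ b, (∀ a, p = PMF.pure a → b = a) ∧ expect p g ≤ g b := by
  by_cases h : ∃ a, p = PMF.pure a
  · obtain ⟨a, rfl⟩ := h
    refine ⟨a, fun b hb => ?_, (expect_pure a g).le⟩
    have h1 : PMF.pure b a = 1 := by rw [← hb, PMF.pure_apply_self]
    by_contra hab
    rw [PMF.pure_apply_of_ne _ _ hab] at h1
    exact zero_ne_one h1
  · obtain ⟨b, hb⟩ := Finite.exists_max g
    exact ⟨b, fun a ha => (h ⟨a, ha⟩).elim, expect_le_of_le p hb⟩

end Expect

/-! ### Occupancy measures -/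

section Occupancy

variable {X A : Type*}

theorem episode_congr {P P' : Dynamics X A} {π π' : Policy X A} (s₀ : X) {n : ℕ}
    (hP : ∀ h < n, P h = P' h) (hπ : ∀ h < n, π h = π' h) :
    episode P π s₀ n = episode P' π' s₀ n := by
  induction n with
  | zero => rfl
  | succ n ih =>
    rw [episode, episode, ih (fun h hh => hP h (hh.trans n.lt_succ_self))
      (fun h hh => hπ h (hh.trans n.lt_succ_self)), hP n n.lt_succ_self, hπ n n.lt_succ_self]

theorem occupancy_congr {P P' : Dynamics X A} {π π' : Policy X A} (s₀ : X) {n : ℕ}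
    (hP : ∀ h < n, P h = P' h) (hπ : ∀ h < n, π h = π' h) :
    occupancy P π s₀ n = occupancy P' π' s₀ n := by
  funext x
  rw [occupancy, occupancy, episode_congr s₀ hP hπ]

theorem occupancy_nonneg (P : Dynamics X A) (π : Policy X A) (s₀ : X) (n : ℕ) (x : X) :
    0 ≤ occupancy P π s₀ n x :=
  ENNReal.toReal_nonneg

theorem occupancy_le_one (P : Dynamics X A) (π : Policy X A) (s₀ : X) (n : ℕ) (x : X) :
    occupancy P π s₀ n x ≤ 1 :=
  ENNReal.toReal_le_of_le_ofReal zero_le_one 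
    ((PMF.coe_le_one _ _).trans_eq ENNReal.ofReal_one.symm)

theorem occupancy_zero [DecidableEq X] (P : Dynamics X A) (π : Policy X A) (s₀ x : X) :
    occupancy P π s₀ 0 x = if x = s₀ then 1 else 0 := by
  have h : (episode P π s₀ 0).map (endState s₀) = PMF.pure s₀ := PMF.pure_map _ _
  rw [occupancy, h, PMF.pure_apply]
  split_ifs <;> simp

variable [Fintype X]

theorem sum_occupancy (P : Dynamics X A) (π : Policy X A) (s₀ : X) (n : ℕ) :
    ∑ x, occupancy P π s₀ n x = 1 :=
  sum_toReal _

variable [Fintype A]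

theorem expect_endState (P : Dynamics X A) (π : Policy X A) (s₀ : X) (n : ℕ) (f : X → ℝ) :
    expect (episode P π s₀ n) (fun τ => f (endState s₀ τ)) =
      ∑ x, occupancy P π s₀ n x * f x :=
  (expect_map (episode P π s₀ n) (endState s₀) f).symm

theorem sum_occupancy_succ (P : Dynamics X A) (π : Policy X A) (s₀ : X) (n : ℕ) (f : X → ℝ) :
    ∑ x, occupancy P π s₀ (n + 1) x * f x =
      ∑ x, occupancy P π s₀ n x * expect (π n x) fun a => expect (P n x a) f := by
  rw [← expect_endState, episode, expect_bind, ← expect_endState]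
  congr 1
  funext τ
  rw [expect_bind]
  congr 1
  funext a
  rw [expect_map]
  simp [endState]

theorem occupancy_succ (P : Dynamics X A) (π : Policy X A) (s₀ : X) (n : ℕ) (x' : X) :
    occupancy P π s₀ (n + 1) x' =
      ∑ x, occupancy P π s₀ n x * expect (π n x) fun a => (P n x a x').toReal := by
  classical
  have h := sum_occupancy_succ P π s₀ n fun x => if x = x' then 1 else 0
  simpa [expect_indicator] using h

/-- The law of a single transition of an episode. -/
theorem expect_episode_step (P : Dynamics X A) (π : Policy X A) (s₀ : X) {n : ℕ} (t : Fin n)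
    (g : X × A × X → ℝ) :
    expect (episode P π s₀ n) (fun τ => g (τ t)) =
      ∑ x, occupancy P π s₀ t x *
        expect (π t x) fun a => expect (P t x a) fun x' => g (x, a, x') := by
  induction n with
  | zero => exact t.elim0
  | succ n ih =>
    rw [episode, expect_bind]
    refine Fin.lastCases ?_ (fun k => ?_) t
    · rw [Fin.val_last, ← expect_endState]
      congr 1
      funext τ
      rw [expect_bind]
      congr 1
      funext a
      rw [expect_map]
      simp
    · rw [Fin.val_castSucc, ← ih k]
      congr 1
      funext τ
      simp [expect_bind, expect_map, expect_const]

theorem value_eq_sum_occupancy (P : Dynamics X A) (r : ℕ → X → A → ℝ) (s₀ : X) (H : ℕ)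
    (π : Policy X A) :
    value P r s₀ H π =
      ∑ h ∈ Finset.range H, ∑ x, occupancy P π s₀ h x * expect (π h x) (r h x) := by
  have h : value P r s₀ H π =
      expect (episode P π s₀ H) fun τ => ∑ h : Fin H, r h (τ h).1 (τ h).2.1 := rfl
  rw [h, expect_sum, Finset.sum_range]
  refine Finset.sum_congr rfl fun t _ => ?_
  rw [expect_episode_step P π s₀ t fun y => r t y.1 y.2.1]
  simp only [expect_const]

/-! ### Deterministic policies suffice -/

/-- The expected total reward of the first `n` steps plus a terminal reward. -/
noncomputable def totalReward (P : Dynamics X A) (r : ℕ → X → A → ℝ) (s₀ : X) (n : ℕ)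
    (π : Policy X A) (f : X → ℝ) : ℝ :=
  ∑ h ∈ Finset.range n, ∑ x, occupancy P π s₀ h x * expect (π h x) (r h x) +
    ∑ x, occupancy P π s₀ n x * f x

/-- Backward dynamic programming: the last step is absorbed into the terminal reward, so induction
on `n` works with `f` arbitrary. Values (`f = 0`) and reaching probabilities (`r = 0`, `f` an
indicator) are both special cases. -/
theorem totalReward_succ (P : Dynamics X A) (r : ℕ → X → A → ℝ) (s₀ : X) (n : ℕ)
    (π : Policy X A) (f : X → ℝ) :
    totalReward P r s₀ (n + 1) π f =
      totalReward P r s₀ n π fun x => expect (π n x) fun a => r n x a + expect (P n x a) f := by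
  simp only [totalReward, Finset.sum_range_succ, sum_occupancy_succ, expect_add, mul_add,
    Finset.sum_add_distrib]
  ring

theorem totalReward_congr (P : Dynamics X A) (r : ℕ → X → A → ℝ) (s₀ : X) {n : ℕ}
    {π π' : Policy X A} (hπ : ∀ h < n, π h = π' h) (f : X → ℝ) :
    totalReward P r s₀ n π f = totalReward P r s₀ n π' f := by
  rw [totalReward, totalReward, occupancy_congr s₀ (fun _ _ => rfl) hπ]
  congr 1
  refine Finset.sum_congr rfl fun h hh => ?_
  have hh := Finset.mem_range.1 hh
  rw [occupancy_congr s₀ (fun _ _ => rfl) (fun k hk => hπ k (hk.trans hh)), hπ h hh]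

theorem totalReward_mono (P : Dynamics X A) (r : ℕ → X → A → ℝ) (s₀ : X) (n : ℕ)
    (π : Policy X A) {f g : X → ℝ} (h : ∀ x, f x ≤ g x) :
    totalReward P r s₀ n π f ≤ totalReward P r s₀ n π g :=
  add_le_add le_rfl (Finset.sum_le_sum fun x _ =>
    mul_le_mul_of_nonneg_left (h x) (occupancy_nonneg P π s₀ n x))

/-- For every policy there is a deterministic one that is at least as good and that agrees with it
wherever the given policy is already deterministic. -/
theorem exists_det_totalReward_ge [Nonempty A] (P : Dynamics X A) (r : ℕ → X → A → ℝ) (s₀ : X)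
    (n : ℕ) (π : Policy X A) (f : X → ℝ) :
    ∃ π' : DetPolicy X A, (∀ h x a, π h x = PMF.pure a → π' h x = a) ∧
      totalReward P r s₀ n π f ≤ totalReward P r s₀ n (det π') f := by
  induction n generalizing f with
  | zero =>
    choose π' hπ' _ using fun h x => exists_action_ge_expect (π h x) 0
    exact ⟨π', hπ', (totalReward_congr P r s₀ (by simp) f).le⟩
  | succ n ih =>
    choose b hb hle using fun x =>
      exists_action_ge_expect (π n x) fun a => r n x a + expect (P n x a) f
    obtain ⟨π', hπ', hπ'le⟩ := ih fun x => r n x (b x) + expect (P n x (b x)) f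
    refine ⟨Function.update π' n b, fun h x a hxa => ?_, ?_⟩
    · rcases eq_or_ne h n with rfl | hn
      · rw [Function.update_self]
        exact hb x a hxa
      · rw [Function.update_of_ne hn]
        exact hπ' h x a hxa
    · rw [totalReward_succ, totalReward_succ]
      refine (totalReward_mono P r s₀ n π hle).trans (hπ'le.trans_eq ?_)
      rw [totalReward_congr P r s₀ (π' := det (Function.update π' n b))]
      · congr 1
        funext x
        simp [det, expect_pure]
      · intro h hh
        funext x
        simp [det, hh.ne]

theorem totalReward_terminal_zero (P : Dynamics X A) (r : ℕ → X → A → ℝ) (s₀ : X) (n : ℕ)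
    (π : Policy X A) : totalReward P r s₀ n π 0 = value P r s₀ n π := by
  simp [totalReward, value_eq_sum_occupancy]

theorem totalReward_indicator [DecidableEq X] (P : Dynamics X A) (s₀ : X) (n : ℕ)
    (π : Policy X A) (y : X) :
    totalReward P 0 s₀ n π (fun x => if x = y then 1 else 0) = occupancy P π s₀ n y := by
  simp [totalReward, expect]

end Occupancy

/-! ### Policies on the states without the sink -/

section Sink

variable {S A : Type*} [Nonempty A]

theorem det_eq_extendPolicy_of_agree {π : Policy S A} {π' : DetPolicy (Option S) A}
    (h : ∀ h x a, extendPolicy π h x = PMF.pure a → π' h x = a) :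
    det π' = extendPolicy (det fun h s => π' h (some s)) := by
  funext k x
  cases x with
  | none =>
    simp only [det, extendPolicy]
    rw [h k none _ rfl]
  | some s => rfl

variable [Fintype S] [Fintype A]

theorem exists_det_sinkValue_ge (Q : Dynamics (Option S) A) (r : ℕ → S → A → ℝ) (s₀ : S) (H : ℕ)
    (π : Policy S A) :
    ∃ π' : DetPolicy S A, sinkValue Q r s₀ H π ≤ sinkValue Q r s₀ H (det π') := by
  obtain ⟨π', h, hle⟩ :=
    exists_det_totalReward_ge Q (extendReward r) (some s₀) H (extendPolicy π) 0
  rw [totalReward_terminal_zero, totalReward_terminal_zero, det_eq_extendPolicy_of_agree h] at hle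
  exact ⟨_, hle⟩

theorem exists_det_sinkOccupancy_ge (Q : Dynamics (Option S) A) (s₀ : S) (n : ℕ)
    (π : Policy S A) (s : S) :
    ∃ π' : DetPolicy S A, sinkOccupancy Q π s₀ n s ≤ sinkOccupancy Q (det π') s₀ n s := by
  classical
  obtain ⟨π', h, hle⟩ := exists_det_totalReward_ge Q 0 (some s₀) n (extendPolicy π)
    fun x => if x = some s then 1 else 0
  rw [totalReward_indicator, totalReward_indicator, det_eq_extendPolicy_of_agree h] at hle
  exact ⟨_, hle⟩

theorem sinkOccupancy_succ {Q : Dynamics (Option S) A} {n : ℕ}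
    (hQ : ∀ a, Q n none a = PMF.pure none) (π : Policy S A) (s₀ s' : S) :
    sinkOccupancy Q π s₀ (n + 1) s' =
      ∑ s, sinkOccupancy Q π s₀ n s *
        expect (π n s) fun a => (Q n (some s) a (some s')).toReal := by
  rw [sinkOccupancy, occupancy_succ, Fintype.sum_option]
  simp [hQ, expect, sinkOccupancy, extendPolicy]

theorem sinkValue_eq_sum_sinkOccupancy (Q : Dynamics (Option S) A) (r : ℕ → S → A → ℝ) (s₀ : S)
    (H : ℕ) (π : Policy S A) :
    sinkValue Q r s₀ H π =
      ∑ h ∈ Finset.range H, ∑ s, sinkOccupancy Q π s₀ h s * expect (π h s) (r h s) := by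
  rw [sinkValue, value_eq_sum_occupancy]
  refine Finset.sum_congr rfl fun h _ => ?_
  rw [Fintype.sum_option]
  simp [extendReward, expect, sinkOccupancy, extendPolicy]

end Sink

/-! ### Planning in accurate dynamics -/

section Accuracy

variable {S A : Type*} [Fintype S]

/-- The `L¹` distance, on the states other than the sink, between estimated and true transition
probabilities. -/
noncomputable def transitionError (Q : Dynamics (Option S) A) (P : Dynamics S A) (i : ℕ) (s : S)
    (a : A) : ℝ :=
  ∑ s', |(Q i (some s) a (some s')).toReal - (P i s a s').toReal|

/-- The dynamics `Q` approximate `P` up to time `H`: states that can be reached with probability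
at least `β` have transition errors that are small relative to the probability of being reached,
and all other states lead to the sink. -/
structure IsAccurate [Nonempty A] (P : Dynamics S A) (Q : Dynamics (Option S) A) (s₀ : S) (H : ℕ)
    (β γ : ℝ) : Prop where
  sink : ∀ i < H, ∀ a, Q i none a = PMF.pure none
  exists_plan : ∀ i < H, ∃ plan : S → DetPolicy S A,
    (∀ s π, sinkOccupancy Q (det π) s₀ i s ≤ sinkOccupancy Q (det (plan s)) s₀ i s) ∧
    (∀ s, β ≤ sinkOccupancy Q (det (plan s)) s₀ i s → ∀ a,
      2 * transitionError Q P i s a ^ 2 * occupancy P (det (plan s)) s₀ i s ≤ γ ^ 2) ∧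
    ∀ s, sinkOccupancy Q (det (plan s)) s₀ i s < β → ∀ a, Q i (some s) a = PMF.pure none

theorem sum_max_le_transitionError {P : Dynamics S A} {Q : Dynamics (Option S) A}
    {σ : ℝ} (hσ : |σ| ≤ 1) (i : ℕ) (s : S) (a : A) :
    ∑ s', max (σ * ((Q i (some s) a (some s')).toReal - (P i s a s').toReal)) 0 ≤
      transitionError Q P i s a := by
  refine Finset.sum_le_sum fun s' _ => max_le ((le_abs_self _).trans ?_) (abs_nonneg _)
  rw [abs_mul]
  exact mul_le_of_le_one_left (abs_nonneg _) hσ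

theorem sum_mul_sub_sum_mul_le {u v g : S → ℝ} (hg : ∀ s, g s ∈ Set.Icc (0 : ℝ) 1) :
    ∑ s, u s * g s - ∑ s, v s * g s ≤ ∑ s, max (u s - v s) 0 := by
  rw [← Finset.sum_sub_distrib]
  refine Finset.sum_le_sum fun s _ => ?_
  rw [← sub_mul]
  exact (mul_le_mul_of_nonneg_right (le_max_left _ 0) (hg s).1).trans
    (mul_le_of_le_one_right (le_max_right _ _) (hg s).2)

theorem sum_range_le_sq_mul {f : ℕ → ℝ} {H : ℕ} {κ : ℝ} (hκ : 0 ≤ κ)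
    (hf : ∀ h < H, f h ≤ h * κ) : ∑ h ∈ Finset.range H, f h ≤ H ^ 2 * κ := by
  refine (Finset.sum_le_card_nsmul _ _ (H * κ) fun h hh => ?_).trans_eq (by simp; ring)
  have hh := Finset.mem_range.1 hh
  exact (hf h hh).trans (mul_le_mul_of_nonneg_right (Nat.cast_le.2 hh.le) hκ)

variable [Fintype A]

theorem expect_mem_Icc (p : PMF A) {f : A → ℝ} (hf : ∀ a, f a ∈ Set.Icc (0 : ℝ) 1) :
    expect p f ∈ Set.Icc (0 : ℝ) 1 :=
  ⟨expect_nonneg p fun a => (hf a).1, expect_le_of_le p fun a => (hf a).2⟩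

/-- Write `u K - v L = (u - v) L + u (K - L)`. The stochastic `L` preserves the mass of the positive
part of `u - v`, and the new error is weighted by `u`, later the learned occupancy. The signs `σ =
1` and `σ = -1` give over- and underestimates. -/
theorem sum_max_mul_sub_le (σ : ℝ) {u : S → ℝ} (v : S → ℝ) (hu : ∀ s, 0 ≤ u s) (π : S → PMF A)
    (K : S → A → S → ℝ) {L : S → A → S → ℝ} (hL : ∀ s a s', 0 ≤ L s a s')
    (hL1 : ∀ s a, ∑ s', L s a s' = 1) :
    ∑ s', max (σ * (∑ s, u s * expect (π s) (fun a => K s a s') -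
        ∑ s, v s * expect (π s) fun a => L s a s')) 0 ≤
      ∑ s, max (σ * (u s - v s)) 0 +
        ∑ s, u s * expect (π s) fun a => ∑ s', max (σ * (K s a s' - L s a s')) 0 := by
  have h : ∀ s', max (σ * (∑ s, u s * expect (π s) (fun a => K s a s') -
        ∑ s, v s * expect (π s) fun a => L s a s')) 0 ≤
      ∑ s, expect (π s) fun a =>
        max (σ * (u s - v s)) 0 * L s a s' + u s * max (σ * (K s a s' - L s a s')) 0 := by
    intro s'
    refine max_le ?_ (Finset.sum_nonneg fun s _ => expect_nonneg _ fun a => ?_)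
    · rw [← Finset.sum_sub_distrib, Finset.mul_sum]
      refine Finset.sum_le_sum fun s _ => ?_
      rw [← expect_mul_left, ← expect_mul_left, ← expect_sub, ← expect_mul_left]
      refine expect_mono _ fun a => ?_
      have h1 := mul_le_mul_of_nonneg_right (le_max_left (σ * (u s - v s)) 0) (hL s a s')
      have h2 := mul_le_mul_of_nonneg_left (le_max_left (σ * (K s a s' - L s a s')) 0) (hu s)
      linarith
    · exact add_nonneg (mul_nonneg (le_max_right _ _) (hL s a s'))
        (mul_nonneg (hu s) (le_max_right _ _))
  refine (Finset.sum_le_sum fun s' _ => h s').trans_eq ?_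
  rw [Finset.sum_comm, ← Finset.sum_add_distrib]
  refine Finset.sum_congr rfl fun s _ => ?_
  rw [← expect_sum]
  simp only [Finset.sum_add_distrib, ← Finset.mul_sum, hL1, mul_one, expect_add, expect_const,
    expect_mul_left]

variable [Nonempty A] {P : Dynamics S A} {Q : Dynamics (Option S) A} {s₀ : S}

theorem sum_max_occupancy_sub_le {H : ℕ} (hQ : ∀ i < H, ∀ a, Q i none a = PMF.pure none) (σ : ℝ)
    {κ : ℝ} (π : Policy S A) {n : ℕ} (hn : n ≤ H)
    (hκ : ∀ i < n, ∀ s a, sinkOccupancy Q π s₀ i s *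
      ∑ s', max (σ * ((Q i (some s) a (some s')).toReal - (P i s a s').toReal)) 0 ≤ κ) :
    ∑ s, max (σ * (sinkOccupancy Q π s₀ n s - occupancy P π s₀ n s)) 0 ≤
      n * (Fintype.card S * κ) := by
  classical
  induction n with
  | zero =>
    refine (Finset.sum_eq_zero fun s _ => ?_).le.trans_eq (by simp)
    simp [sinkOccupancy, occupancy_zero]
  | succ n ih =>
    have ih := ih (by omega) fun i hi => hκ i (by omega)
    have hstep := sum_max_mul_sub_le σ (u := sinkOccupancy Q π s₀ n) (occupancy P π s₀ n)
      (fun s => occupancy_nonneg _ _ _ _ _) (π n)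
      (fun s a s' => (Q n (some s) a (some s')).toReal) (L := fun s a s' => (P n s a s').toReal)
      (fun _ _ _ => ENNReal.toReal_nonneg) (fun s a => sum_toReal _)
    simp only [← sinkOccupancy_succ (hQ n (by omega)), ← occupancy_succ] at hstep
    have hlast : ∑ s, sinkOccupancy Q π s₀ n s * expect (π n s) (fun a =>
        ∑ s', max (σ * ((Q n (some s) a (some s')).toReal - (P n s a s').toReal)) 0) ≤
        Fintype.card S * κ := by
      refine (Finset.sum_le_card_nsmul _ _ κ fun s _ => ?_).trans_eq (by simp)
      rw [← expect_mul_left]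
      exact expect_le_of_le _ fun a => hκ n (by omega) s a
    push_cast
    linarith

namespace IsAccurate

variable {H : ℕ} {β γ : ℝ}

theorem weighted_error_le (hacc : IsAccurate P Q s₀ H β γ) (hγ : 0 ≤ γ) {i : ℕ} (hi : i < H)
    (hgap : ∀ π : Policy S A,
      ∑ s, max (sinkOccupancy Q π s₀ i s - occupancy P π s₀ i s) 0 ≤ β / 2)
    (π : Policy S A) (s : S) :
    (∀ a, sinkOccupancy Q π s₀ i s * transitionError Q P i s a ≤ γ) ∨
      sinkOccupancy Q π s₀ i s ≤ β ∧ ∀ a, Q i (some s) a = PMF.pure none := by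
  obtain ⟨plan, hmax, hactive, hinactive⟩ := hacc.exists_plan i hi
  obtain ⟨π', hπ'⟩ := exists_det_sinkOccupancy_ge Q s₀ i π s
  have hle := hπ'.trans (hmax s π')
  rcases le_or_gt β (sinkOccupancy Q (det (plan s)) s₀ i s) with hβ | hβ
  · left
    intro a
    have h1 := hactive s hβ a
    have h2 : sinkOccupancy Q (det (plan s)) s₀ i s - occupancy P (det (plan s)) s₀ i s ≤ β / 2 :=
      (le_max_left _ 0).trans ((Finset.single_le_sum
        (f := fun s' => max (sinkOccupancy Q (det (plan s)) s₀ i s' -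
          occupancy P (det (plan s)) s₀ i s') 0)
        (fun _ _ => le_max_right _ _) (Finset.mem_univ s)).trans (hgap _))
    refine le_of_sq_le_sq ?_ hγ
    have h3 : 0 ≤ sinkOccupancy Q π s₀ i s := occupancy_nonneg _ _ _ _ _
    have h4 : sinkOccupancy Q π s₀ i s ≤ 1 := occupancy_le_one _ _ _ _ _
    -- With `u`, `û`, `p` as in the overview: `u ^ 2 ≤ u ≤ û`, and `û - p ≤ β / 2 ≤ û / 2` gives `û
    -- ≤ 2 * p`.
    have h5 : sinkOccupancy Q π s₀ i s ^ 2 ≤ 2 * occupancy P (det (plan s)) s₀ i s := by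
      nlinarith
    have h6 := mul_le_mul_of_nonneg_left h5 (sq_nonneg (transitionError Q P i s a))
    rw [mul_pow]
    linarith
  · exact Or.inr ⟨hle.trans hβ.le, hinactive s hβ⟩

/-- The gap that `weighted_error_le` requires at time `i < n` is this very bound at the earlier
time, for all policies; hence the strong induction with `π` general. -/
theorem sum_max_overestimate_le (hacc : IsAccurate P Q s₀ H β γ) (hγ : 0 ≤ γ)
    (hβγ : H * (Fintype.card S * γ) ≤ β / 2) {n : ℕ} (hn : n ≤ H) (π : Policy S A) :
    ∑ s, max (sinkOccupancy Q π s₀ n s - occupancy P π s₀ n s) 0 ≤ n * (Fintype.card S * γ) := by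
  induction n using Nat.strong_induction_on generalizing π with
  | _ n ih =>
    have h := sum_max_occupancy_sub_le (P := P) (s₀ := s₀) hacc.sink 1 (κ := γ) π hn ?_
    · simpa only [one_mul] using h
    intro i hi s a
    have hgap : ∀ π : Policy S A,
        ∑ s, max (sinkOccupancy Q π s₀ i s - occupancy P π s₀ i s) 0 ≤ β / 2 := fun π =>
      (ih i hi (by omega) π).trans ((mul_le_mul_of_nonneg_right
        (Nat.cast_le.2 (by omega)) (by positivity)).trans hβγ)
    rcases hacc.weighted_error_le hγ (by omega) hgap π s with h | h
    · exact (mul_le_mul_of_nonneg_left (sum_max_le_transitionError (by simp) i s a)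
        (occupancy_nonneg _ _ _ _ _)).trans (h a)
    -- An inactive row puts no mass on `S`, so it never exceeds the true row.
    · simp [h.2, hγ]

theorem sum_max_underestimate_le (hacc : IsAccurate P Q s₀ H β γ) (hγ : 0 ≤ γ) (hβ : 0 ≤ β)
    (hβγ : H * (Fintype.card S * γ) ≤ β / 2) {n : ℕ} (hn : n ≤ H) (π : Policy S A) :
    ∑ s, max (occupancy P π s₀ n s - sinkOccupancy Q π s₀ n s) 0 ≤
      n * (Fintype.card S * (γ + β)) := by
  have h := sum_max_occupancy_sub_le (P := P) (s₀ := s₀) hacc.sink (-1) (κ := γ + β) π hn ?_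
  · simpa only [neg_one_mul, neg_sub] using h
  intro i hi s a
  have hgap : ∀ π : Policy S A,
      ∑ s, max (sinkOccupancy Q π s₀ i s - occupancy P π s₀ i s) 0 ≤ β / 2 := fun π =>
    (hacc.sum_max_overestimate_le hγ hβγ (by omega) π).trans ((mul_le_mul_of_nonneg_right
      (Nat.cast_le.2 (by omega)) (by positivity)).trans hβγ)
  rcases hacc.weighted_error_le hγ (by omega) hgap π s with h | h
  · exact (mul_le_mul_of_nonneg_left (sum_max_le_transitionError (by simp) i s a)
      (occupancy_nonneg _ _ _ _ _)).trans ((h a).trans (le_add_of_nonneg_right hβ))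
  -- Here the whole true row, of mass `1`, is lost; the weight is at most `β`.
  · have h1 : ∑ s', max (-1 * ((Q i (some s) a (some s')).toReal - (P i s a s').toReal)) 0 = 1 :=
      (Finset.sum_congr rfl fun s' _ => by simp [h.2]).trans (sum_toReal (P i s a))
    rw [h1, mul_one]
    exact h.1.trans (le_add_of_nonneg_left hγ)

/-- A policy that is optimal for accurate dynamics is nearly optimal for the true ones. -/
theorem value_sub_value_le (hacc : IsAccurate P Q s₀ H β γ) (hγ : 0 ≤ γ) (hβ : 0 ≤ β)
    (hβγ : H * (Fintype.card S * γ) ≤ β / 2) {r : ℕ → S → A → ℝ}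
    (hr : ∀ h < H, ∀ s a, r h s a ∈ Set.Icc (0 : ℝ) 1) {πhat : Policy S A}
    (hopt : ∀ π : DetPolicy S A, sinkValue Q r s₀ H (det π) ≤ sinkValue Q r s₀ H πhat)
    (π : Policy S A) :
    value P r s₀ H π - value P r s₀ H πhat ≤
      H ^ 2 * (Fintype.card S * (2 * γ + β)) := by
  -- Optimality of `πhat` is assumed only against deterministic policies.
  obtain ⟨π', hπ'⟩ := exists_det_sinkValue_ge Q r s₀ H π
  have h1 : value P r s₀ H π - sinkValue Q r s₀ H π ≤ H ^ 2 * (Fintype.card S * (γ + β)) := by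
    rw [value_eq_sum_occupancy, sinkValue_eq_sum_sinkOccupancy, ← Finset.sum_sub_distrib]
    exact sum_range_le_sq_mul (by positivity) fun h hh =>
      (sum_mul_sub_sum_mul_le fun s => expect_mem_Icc _ (hr h hh s)).trans
        (hacc.sum_max_underestimate_le hγ hβ hβγ hh.le π)
  have h2 : sinkValue Q r s₀ H πhat - value P r s₀ H πhat ≤ H ^ 2 * (Fintype.card S * γ) := by
    rw [value_eq_sum_occupancy, sinkValue_eq_sum_sinkOccupancy, ← Finset.sum_sub_distrib]
    exact sum_range_le_sq_mul (by positivity) fun h hh =>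
      (sum_mul_sub_sum_mul_le fun s => expect_mem_Icc _ (hr h hh s)).trans
        (hacc.sum_max_overestimate_le hγ hβγ hh.le πhat)
  linarith [hopt π']

end IsAccurate

end Accuracy

/-! ### Concentration -/

section Concentration

theorem toOuterMeasure_le_ofReal_expect {Y : Type*} [Fintype Y] (p : PMF Y) {s : Set Y}
    {f : Y → ℝ} (hf : ∀ y, 0 ≤ f y) (hs : ∀ y ∈ s, 1 ≤ f y) :
    p.toOuterMeasure s ≤ ENNReal.ofReal (expect p f) := by
  rw [PMF.toOuterMeasure_apply_fintype, expect, ENNReal.ofReal_sum_of_nonneg fun y _ =>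
    mul_nonneg ENNReal.toReal_nonneg (hf y)]
  refine Finset.sum_le_sum fun y _ => Set.indicator_apply_le' (fun hy => ?_) fun _ => zero_le
  refine ENNReal.le_ofReal_iff_toReal_le (p.apply_ne_top y)
    (mul_nonneg ENNReal.toReal_nonneg (hf y)) |>.2 ?_
  exact le_mul_of_one_le_right ENNReal.toReal_nonneg (hs y hy)

theorem expect_independent_prod {ι Y : Type*} [Fintype ι] [DecidableEq ι] [Fintype Y]
    (p : ι → PMF Y) (f : ι → Y → ℝ) :
    expect (independent p) (fun y => ∏ j, f j (y j)) = ∏ j, expect (p j) (f j) := by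
  simp only [expect, independent, PMF.ofFintype_apply, ENNReal.toReal_prod,
    ← Finset.prod_mul_distrib]
  rw [Finset.prod_univ_sum, Fintype.piFinset_univ]

theorem independent_toOuterMeasure_sum_nonneg_le {ι Y : Type*} [Fintype ι] [DecidableEq ι]
    [Fintype Y] (p : ι → PMF Y) (X : Y → ℝ) :
    (independent p).toOuterMeasure {y | 0 ≤ ∑ j, X (y j)} ≤
      ENNReal.ofReal (∏ j, expect (p j) fun y => Real.exp (X y)) := by
  rw [← expect_independent_prod]
  refine toOuterMeasure_le_ofReal_expect _ (fun y => Finset.prod_nonneg fun j _ =>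
    (Real.exp_pos _).le) fun y hy => ?_
  rw [← Real.exp_sum]
  exact Real.one_le_exp hy

open Classical in
-- Apply `exp x ≤ 1 + x + x ^ 2`: the exponent has mean `-l ^ 2` and second moment `l ^ 2 * q * (1 -
-- q) + l ^ 4 ≤ l ^ 2 / 2`. The drift `-l ^ 2` makes every visit shrink the moment, so no separate
-- lower bound on the number of visits is needed.
theorem expect_exp_deviation_le {S : Type*} [Fintype S] (p : PMF S) (B : Finset S) {l : ℝ}
    (hl : 0 ≤ l) (hl' : l ≤ 1 / 2) :
    expect p (fun s => Real.exp (l * ((if s ∈ B then 1 else 0) - ∑ s' ∈ B, (p s').toReal) - l ^ 2))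
      ≤ 1 - l ^ 2 / 2 := by
  set q := ∑ s' ∈ B, (p s').toReal with hq
  have hq0 : 0 ≤ q := Finset.sum_nonneg fun _ _ => ENNReal.toReal_nonneg
  have hq1 : q ≤ 1 := by
    rw [← sum_toReal p]
    exact Finset.sum_le_sum_of_subset_of_nonneg (Finset.subset_univ B)
      fun _ _ _ => ENNReal.toReal_nonneg
  have hind : expect p (fun s => if s ∈ B then 1 else 0) = q := by
    simp [expect, hq]
  have hl2 : l ^ 2 ≤ 1 / 4 := by nlinarith
  have hlq : l * q ≤ 1 / 2 := by nlinarith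
  have hlq0 : 0 ≤ l * q := mul_nonneg hl hq0
  set c := l * q + l ^ 2 with hc
  have hexp : ∀ x : ℝ, |x| ≤ 1 → Real.exp x ≤ 1 + x + x ^ 2 := fun x hx => by
    have := (abs_le.1 (Real.abs_exp_sub_one_sub_id_le hx)).2
    linarith
  -- The exponent is `-c` or `l - c`, so the quadratic bound is affine in the indicator.
  have hpt : ∀ s, Real.exp (l * ((if s ∈ B then 1 else 0) - q) - l ^ 2) ≤
      (1 - c + c ^ 2) + (l + l ^ 2 - 2 * l * c) * (if s ∈ B then 1 else 0) := by
    intro s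
    refine (hexp _ ?_).trans_eq ?_
    · rw [abs_le]
      have := sq_nonneg l
      split_ifs <;> constructor <;> linarith
    · split_ifs <;> ring
  refine (expect_mono p hpt).trans ?_
  rw [expect_add, expect_const, expect_mul_left, hind]
  have h1 : (1 - c + c ^ 2) + (l + l ^ 2 - 2 * l * c) * q =
      1 - l ^ 2 + l ^ 2 * (q * (1 - q)) + l ^ 2 * l ^ 2 := by rw [hc]; ring
  have h2 : q * (1 - q) ≤ 1 / 4 := by nlinarith [sq_nonneg (q - 1 / 2)]
  rw [h1]
  nlinarith [mul_le_mul_of_nonneg_left h2 (sq_nonneg l), mul_le_mul_of_nonneg_left hl2 (sq_nonneg l)]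

end Concentration

/-! ### Deviations in the data of one phase -/

section Phase

variable {S A : Type*} {m H : ℕ}

theorem occupancy_groupPolicy (P : Dynamics S A) (plan : S → DetPolicy S A) (s₀ : S) (i : ℕ)
    (g : S × A) :
    occupancy P (det (groupPolicy plan i g)) s₀ i = occupancy P (det (plan g.1)) s₀ i := by
  refine occupancy_congr s₀ (fun _ _ => rfl) fun h hh => ?_
  funext x
  simp [det, groupPolicy, hh.ne]

theorem groupPolicy_self (plan : S → DetPolicy S A) (i : ℕ) (g : S × A) :
    groupPolicy plan i g i g.1 = g.2 := by
  simp [groupPolicy]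

open Classical in
theorem count_eq_sum (d : PhaseData S A m H) (t : Fin H) (s : S) (a : A) (s' : S) :
    (count d t s a s' : ℝ) = ∑ j, if d j t = (s, a, s') then 1 else 0 := by
  have h : ∀ j, (∃ u : Fin H, (u : ℕ) = t ∧ d j u = (s, a, s')) ↔ d j t = (s, a, s') := fun j =>
    ⟨fun ⟨u, hu, h⟩ => Fin.ext hu ▸ h, fun h => ⟨t, rfl, h⟩⟩
  rw [count, Nat.card_eq_fintype_card, Fintype.card_subtype, Finset.sum_boole]
  simp only [h]

open Classical in
theorem sum_count_eq_sum (d : PhaseData S A m H) (t : Fin H) (s : S) (a : A) (B : Finset S) :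
    ∑ s' ∈ B, (count d t s a s' : ℝ) =
      ∑ j, if (d j t).1 = s ∧ (d j t).2.1 = a ∧ (d j t).2.2 ∈ B then 1 else 0 := by
  simp only [count_eq_sum]
  rw [Finset.sum_comm]
  refine Finset.sum_congr rfl fun j _ => ?_
  obtain ⟨x, b, x'⟩ := d j t
  simp only [Prod.mk.injEq]
  by_cases h : x = s ∧ b = a
  · simp [h.1, h.2]
  · rw [if_neg (by tauto)]
    exact Finset.sum_eq_zero fun _ _ => if_neg (by tauto)

variable [Fintype S]

open Classical in
/-- For a transition from `s` under `a`, a tilted deviation of the event that the next state is in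
`B` from its probability. -/
noncomputable def deviation (P : Dynamics S A) (i : ℕ) (s : S) (a : A) (B : Finset S) (l : ℝ)
    (x : S × A × S) : ℝ :=
  if x.1 = s ∧ x.2.1 = a then
    l * ((if x.2.2 ∈ B then 1 else 0) - ∑ s' ∈ B, (P i s a s').toReal) - l ^ 2
  else 0

open Classical in
-- An episode missing `(s, a)` at time `t` contributes `exp 0 = 1`, so the saving `l ^ 2 / 2` is
-- multiplied by the probability of a visit.
theorem expect_episode_exp_deviation_le [Fintype A] (P : Dynamics S A) (π : DetPolicy S A) (s₀ : S)
    {n : ℕ} (t : Fin n) (s : S) (a : A) (B : Finset S) {l : ℝ} (hl : 0 ≤ l) (hl' : l ≤ 1 / 2) :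
    expect (episode P (det π) s₀ n) (fun τ => Real.exp (deviation P t s a B l (τ t))) ≤
      Real.exp (-(l ^ 2 / 2 * if π t s = a then occupancy P (det π) s₀ t s else 0)) := by
  rw [expect_episode_step P (det π) s₀ t fun x => Real.exp (deviation P t s a B l x)]
  simp only [det, expect_pure]
  have h : ∀ x, expect (P t x (π t x)) (fun x' =>
      Real.exp (deviation P t s a B l (x, π t x, x'))) ≤
      1 - if x = s then (if π t s = a then l ^ 2 / 2 else 0) else 0 := by
    intro x
    by_cases hx : x = s
    · subst hx
      by_cases ha : π t x = a
      · subst ha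
        simpa [deviation] using expect_exp_deviation_le (P t x (π t x)) B hl hl'
      · simp [deviation, ha, expect_const]
    · simp [deviation, hx, expect_const]
  refine (Finset.sum_le_sum fun x _ =>
    mul_le_mul_of_nonneg_left (h x) (occupancy_nonneg P _ s₀ t x)).trans ?_
  simp only [mul_sub, mul_one, Finset.sum_sub_distrib, sum_occupancy, mul_ite, mul_zero,
    Finset.sum_ite_eq', Finset.mem_univ, if_true]
  refine le_trans (le_of_eq ?_) (Real.one_sub_le_exp_neg _)
  split_ifs
  · rw [mul_comm]
  · rfl

/-- Agents outside the group contribute factors at most `1`. Those inside reach `s` with the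
probability of the plan, since the override acts only upon arrival. -/
theorem phase_toOuterMeasure_deviation_le [Fintype A] (P : Dynamics S A) (c : Choices S A m H)
    (s₀ : S) (T : Transcript S A m H) (t : Fin H) (hT : (t : ℕ) = T.length) (s : S) (a : A)
    (B : Finset S) {l : ℝ} (hl : 0 ≤ l) (hl' : l ≤ 1 / 2) {n : ℝ}
    (hn : n ≤ Nat.card {j // c.assign T j = (s, a)}) :
    (phase P c s₀ T).toOuterMeasure {d | 0 ≤ ∑ j, deviation P t s a B l (d j t)} ≤
      ENNReal.ofReal (Real.exp
        (-(l ^ 2 / 2 * (n * occupancy P (det (c.plan T s)) s₀ T.length s)))) := by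
  classical
  refine (independent_toOuterMeasure_sum_nonneg_le _ fun τ : Trajectory S A H =>
    deviation P t s a B l (τ t)).trans (ENNReal.ofReal_le_ofReal ?_)
  refine (Finset.prod_le_prod (fun j _ => expect_nonneg _ fun _ => (Real.exp_pos _).le) fun j _ =>
    expect_episode_exp_deviation_le P _ s₀ t s a B hl hl').trans ?_
  rw [← Real.exp_sum, Real.exp_le_exp, Finset.sum_neg_distrib, neg_le_neg_iff, ← Finset.mul_sum]
  refine mul_le_mul_of_nonneg_left ?_ (by positivity)
  refine (mul_le_mul_of_nonneg_right hn (occupancy_nonneg _ _ _ _ _)).trans ?_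
  rw [Nat.card_eq_fintype_card, Fintype.card_subtype, ← nsmul_eq_mul, ← Finset.sum_const,
    Finset.sum_filter]
  refine Finset.sum_le_sum fun j _ => ?_
  split_ifs with h1 h2 h2
  · rw [hT, occupancy_groupPolicy, h1]
  · refine (h2 ?_).elim
    rw [hT, h1]
    exact groupPolicy_self _ _ (s, a)
  · exact occupancy_nonneg _ _ _ _ _
  · exact le_rfl

/-- For `l > 0` the sum is negative exactly when `(s, a)` was visited and the empirical frequency of
`B` is below its probability plus `l`. -/
theorem sum_deviation (P : Dynamics S A) (d : PhaseData S A m H) (t : Fin H) (s : S) (a : A)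
    (B : Finset S) (l : ℝ) :
    ∑ j, deviation P t s a B l (d j t) =
      l * (∑ s' ∈ B, (count d t s a s' : ℝ) -
        (∑ s' ∈ B, (P t s a s').toReal + l) * ∑ s', (count d t s a s' : ℝ)) := by
  classical
  rw [sum_count_eq_sum, sum_count_eq_sum, Finset.mul_sum, ← Finset.sum_sub_distrib, Finset.mul_sum]
  refine Finset.sum_congr rfl fun j _ => ?_
  rw [deviation]
  by_cases h1 : (d j t).1 = s <;> by_cases h2 : (d j t).2.1 = a <;>
    by_cases h3 : (d j t).2.2 ∈ B <;> simp [h1, h2, h3] <;> ring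

/-! ### The empirical transitions -/

theorem map_some_apply {Y : Type*} (p : PMF Y) (y : Y) : p.map some (some y) = p y := by
  classical
  rw [PMF.map_apply, tsum_eq_single y]
  · simp
  · intro z hz
    simp [hz.symm]

theorem empirical_toReal_of_pos {act : Set S} {d : PhaseData S A m H} {i : ℕ} {s : S} {a : A}
    (hs : s ∈ act) (hN : 0 < ∑ s', (count d i s a s' : ℝ)) (s' : S) :
    (empirical act d i (some s) a (some s')).toReal =
      count d i s a s' / ∑ s'', (count d i s a s'' : ℝ) := by
  have hsum : ∑' s', (count d i s a s' : ℝ≥0∞) = ((∑ s', count d i s a s' : ℕ) : ℝ≥0∞) := by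
    rw [tsum_fintype, Nat.cast_sum]
  have h : s ∈ act ∧ ∑' s', (count d i s a s' : ℝ≥0∞) ≠ 0 := by
    refine ⟨hs, ?_⟩
    rw [hsum, Nat.cast_ne_zero]
    rintro h0
    rw [← Nat.cast_sum, h0, Nat.cast_zero] at hN
    exact hN.false
  rw [empirical, dif_pos h, map_some_apply, PMF.normalize_apply, hsum, ENNReal.toReal_mul,
    ENNReal.toReal_inv, ENNReal.toReal_natCast, ENNReal.toReal_natCast, Nat.cast_sum,
    div_eq_mul_inv]

/-- Use `|x| = 2 * max x 0 - x`; equal totals cancel the last term, so one-sided bounds suffice. -/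
theorem sum_abs_sub_le_of_forall_finset {p q : S → ℝ} {l : ℝ} (hsum : ∑ s, p s = ∑ s, q s)
    (h : ∀ B : Finset S, ∑ s ∈ B, p s ≤ ∑ s ∈ B, q s + l) : ∑ s, |p s - q s| ≤ 2 * l := by
  classical
  have h1 : ∑ s, |p s - q s| =
      2 * ∑ s with q s ≤ p s, (p s - q s) - (∑ s, p s - ∑ s, q s) := by
    rw [Finset.sum_filter, ← Finset.sum_sub_distrib, Finset.mul_sum, ← Finset.sum_sub_distrib]
    refine Finset.sum_congr rfl fun s _ => ?_
    split_ifs with hs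
    · rw [abs_of_nonneg (sub_nonneg.2 hs)]
      ring
    · rw [abs_of_neg (sub_neg.2 (not_le.1 hs))]
      ring
  have h2 := h {s | q s ≤ p s}
  rw [h1, hsum, Finset.sum_sub_distrib]
  linarith

theorem sum_some_le_one {Y : Type*} [Fintype Y] (p : PMF (Option Y)) :
    ∑ y, (p (some y)).toReal ≤ 1 := by
  have h := sum_toReal p
  rw [Fintype.sum_option] at h
  linarith [(ENNReal.toReal_nonneg : 0 ≤ (p none).toReal)]

theorem transitionError_nonneg (Q : Dynamics (Option S) A) (P : Dynamics S A) (i : ℕ) (s : S)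
    (a : A) : 0 ≤ transitionError Q P i s a :=
  Finset.sum_nonneg fun _ _ => abs_nonneg _

theorem transitionError_le_two (Q : Dynamics (Option S) A) (P : Dynamics S A) (i : ℕ) (s : S)
    (a : A) : transitionError Q P i s a ≤ 2 := by
  have h : transitionError Q P i s a ≤
      ∑ s', ((Q i (some s) a (some s')).toReal + (P i s a s').toReal) :=
    Finset.sum_le_sum fun s' _ => (abs_sub _ _).trans_eq (by
      rw [abs_of_nonneg ENNReal.toReal_nonneg, abs_of_nonneg ENNReal.toReal_nonneg])
  rw [Finset.sum_add_distrib, sum_toReal] at h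
  linarith [sum_some_le_one (Q i (some s) a)]

theorem transitionError_empirical_le {act : Set S} {P : Dynamics S A} {d : PhaseData S A m H}
    {Q : Dynamics (Option S) A} {t : Fin H} {s : S} {a : A} (hs : s ∈ act)
    (hQ : Q t = empirical act d t) {l : ℝ} (hl : 0 < l)
    (hd : ∀ B : Finset S, ∑ j, deviation P t s a B l (d j t) < 0) :
    transitionError Q P t s a ≤ 2 * l := by
  have hB : ∀ B : Finset S, ∑ s' ∈ B, (count d t s a s' : ℝ) <
      (∑ s' ∈ B, (P t s a s').toReal + l) * ∑ s', (count d t s a s' : ℝ) := fun B => by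
    have h := hd B
    rw [sum_deviation] at h
    exact sub_neg.1 (neg_of_mul_neg_right h hl.le)
  -- The empty set already forces a visit: its inequality reads `0 < l * N`.
  have hN : 0 < ∑ s', (count d t s a s' : ℝ) := by
    have h := hB ∅
    simp only [Finset.sum_empty, zero_add] at h
    exact pos_of_mul_pos_right h hl.le
  refine sum_abs_sub_le_of_forall_finset ?_ fun B => ?_
  · rw [sum_toReal]
    simp only [hQ, empirical_toReal_of_pos hs hN]
    rw [← Finset.sum_div, div_self hN.ne']
  · simp only [hQ, empirical_toReal_of_pos hs hN]
    rw [← Finset.sum_div, div_le_iff₀ hN]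
    exact (hB B).le

end Phase

section Algorithm

variable {S A : Type*} [Fintype S] [Nonempty A] {m H : ℕ} {c : Choices S A m H} {s₀ : S} {β γ : ℝ}

/-! ### Learned dynamics -/

theorem learned_cons_self (c : Choices S A m H) (s₀ : S) (β : ℝ) (d : PhaseData S A m H)
    (T : Transcript S A m H) :
    learned c s₀ β (d :: T) T.length = empirical (active c s₀ β T) d T.length := by
  simp [learned, active]

theorem learned_cons_of_ne (c : Choices S A m H) (s₀ : S) (β : ℝ) (d : PhaseData S A m H)
    (T : Transcript S A m H) {i : ℕ} (hi : i ≠ T.length) :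
    learned c s₀ β (d :: T) i = learned c s₀ β T i := by
  simp [learned, hi]

theorem sinkOccupancy_learned_cons (c : Choices S A m H) (s₀ : S) (β : ℝ) (d : PhaseData S A m H)
    (T : Transcript S A m H) (π : Policy S A) {i : ℕ} (hi : i ≤ T.length) (s : S) :
    sinkOccupancy (learned c s₀ β (d :: T)) π s₀ i s =
      sinkOccupancy (learned c s₀ β T) π s₀ i s := by
  rw [sinkOccupancy, sinkOccupancy, occupancy_congr (some s₀)
    (fun h hh => learned_cons_of_ne c s₀ β d T (by omega)) fun _ _ => rfl]

/-- The data of a phase give accurate transition estimates for the active states. -/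
def PhaseAccurate (P : Dynamics S A) (c : Choices S A m H) (s₀ : S) (β γ : ℝ)
    (T : Transcript S A m H) (d : PhaseData S A m H) : Prop :=
  ∀ s ∈ active c s₀ β T, ∀ a,
    2 * transitionError (learned c s₀ β (d :: T)) P T.length s a ^ 2 *
      occupancy P (det (c.plan T s)) s₀ T.length s ≤ γ ^ 2

/-- All phases recorded in a transcript give accurate estimates. -/
def RunAccurate (P : Dynamics S A) (c : Choices S A m H) (s₀ : S) (β γ : ℝ) :
    Transcript S A m H → Prop
  | [] => True
  | d :: T => RunAccurate P c s₀ β γ T ∧ PhaseAccurate P c s₀ β γ T d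

/-- A phase changes only the transitions at its own time, so occupancies up to that time, and with
them plans and active states, survive all later phases. -/
theorem RunAccurate.isAccurate_learned {P : Dynamics S A} (hc : c.Valid s₀ β)
    {T : Transcript S A m H} (hT : RunAccurate P c s₀ β γ T) :
    IsAccurate P (learned c s₀ β T) s₀ T.length β γ := by
  induction T with
  | nil => exact ⟨by simp, by simp⟩
  | cons d T ih =>
    have ih := ih hT.1
    refine ⟨fun i hi a => ?_, fun i hi => ?_⟩
    · rcases eq_or_ne i T.length with rfl | hne
      · rw [learned_cons_self]
        rfl
      · rw [learned_cons_of_ne _ _ _ _ _ hne]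
        exact ih.sink i (by simp at hi; omega) a
    · have hle : i ≤ T.length := by simp at hi; omega
      simp only [sinkOccupancy_learned_cons c s₀ β d T _ hle]
      rcases eq_or_ne i T.length with rfl | hne
      · refine ⟨c.plan T, fun s π => hc.plan_max T s π, fun s hs a => hT.2 s hs a,
          fun s hs a => ?_⟩
        have hs' : ¬ s ∈ active c s₀ β T := not_le.2 hs
        rw [learned_cons_self, empirical, dif_neg fun h => hs' h.1]
      · obtain ⟨plan, h1, h2, h3⟩ := ih.exists_plan i (by omega)
        refine ⟨plan, h1, fun s hs a => ?_, fun s hs a => ?_⟩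
        · simpa only [transitionError, learned_cons_of_ne c s₀ β d T hne] using h2 s hs a
        · rw [learned_cons_of_ne _ _ _ _ _ hne, h3 s hs a]

theorem toOuterMeasure_univ {Y : Type*} (p : PMF Y) : p.toOuterMeasure Set.univ = 1 :=
  (PMF.toOuterMeasure_apply_eq_one_iff _ _).2 (Set.subset_univ _)

theorem toOuterMeasure_le_one {Y : Type*} (p : PMF Y) (s : Set Y) : p.toOuterMeasure s ≤ 1 :=
  (MeasureTheory.measure_mono (Set.subset_univ s)).trans_eq (toOuterMeasure_univ p)

/-! ### The probability of accurate estimates -/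

variable [Fintype A]

/-- Groups of inactive states are empty and the others differ by at most one, so `m ≤ S * A * (k +
1)` for the group size `k`; the assumption on `m` absorbs the `+ 1`. -/
theorem Choices.Valid.le_card_group (hc : c.Valid s₀ β)
    (hm : 2 * ((Fintype.card S : ℝ) * Fintype.card A) ≤ m) {T : Transcript S A m H} {s : S}
    (hs : s ∈ active c s₀ β T) (a : A) :
    (m : ℝ) / (2 * (Fintype.card S * Fintype.card A)) ≤ Nat.card {j // c.assign T j = (s, a)} := by
  classical
  have hle : ∀ g : S × A, Nat.card {j // c.assign T j = g} ≤
      Nat.card {j // c.assign T j = (s, a)} + 1 := by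
    rintro ⟨s', a'⟩
    by_cases hs' : s' ∈ active c s₀ β T
    · exact hc.assign_equal T s' hs' s hs a' a
    · have : IsEmpty {j // c.assign T j = (s', a')} :=
        ⟨fun j => hs' (by simpa [j.2] using hc.assign_mem T ⟨s, hs⟩ j.1)⟩
      simp
  have hsum : m = ∑ g : S × A, Nat.card {j // c.assign T j = g} := by
    have h := Finset.card_eq_sum_card_fiberwise (f := c.assign T) (s := Finset.univ)
      (t := Finset.univ) (by simp)
    simpa [Nat.card_eq_fintype_card, Fintype.card_subtype] using h
  have hmul : m ≤ Fintype.card S * Fintype.card A *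
      (Nat.card {j // c.assign T j = (s, a)} + 1) := by
    conv_lhs => rw [hsum]
    refine (Finset.sum_le_card_nsmul _ _ _ fun g _ => hle g).trans_eq ?_
    simp
  have hmul' : (m : ℝ) ≤ Fintype.card S * Fintype.card A *
      (Nat.card {j // c.assign T j = (s, a)} + 1) := by exact_mod_cast hmul
  have hS : (0 : ℝ) < Fintype.card S := Nat.cast_pos.2 (Fintype.card_pos_iff.2 ⟨s⟩)
  have hA : (0 : ℝ) < Fintype.card A := Nat.cast_pos.2 Fintype.card_pos
  rw [div_le_iff₀ (by positivity)]
  linarith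

theorem phase_transitionError_le (P : Dynamics S A) {T : Transcript S A m H} (hT : T.length < H)
    {s : S} (hs : s ∈ active c s₀ β T) (a : A) (hγ : 0 < γ) {n L : ℝ}
    (hn : n ≤ Nat.card {j // c.assign T j = (s, a)}) (hL : L ≤ γ ^ 2 * n / 64) :
    (phase P c s₀ T).toOuterMeasure
        {d | γ ^ 2 < 2 * transitionError (learned c s₀ β (d :: T)) P T.length s a ^ 2 *
          occupancy P (det (c.plan T s)) s₀ T.length s} ≤
      2 ^ Fintype.card S * ENNReal.ofReal (Real.exp (-L)) := by
  classical
  set p := occupancy P (det (c.plan T s)) s₀ T.length s with hp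
  have hp0 : 0 ≤ p := occupancy_nonneg _ _ _ _ _
  -- For rarely reached states the trivial bound `2` on the error is enough: `2 * 2 ^ 2 * p ≤ γ ^
  -- 2`.
  rcases le_or_gt (8 * p) (γ ^ 2) with h8 | h8
  · rw [Set.eq_empty_of_forall_notMem (s := {d | _}), MeasureTheory.measure_empty]
    · exact zero_le
    · refine fun d hd => absurd hd (not_lt.2 (le_trans ?_ h8))
      have h1 := transitionError_le_two (learned c s₀ β (d :: T)) P T.length s a
      have h2 := transitionError_nonneg (learned c s₀ β (d :: T)) P T.length s a
      exact mul_le_mul_of_nonneg_right (by nlinarith) hp0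
  · have hppos : 0 < p := by nlinarith [sq_nonneg γ]
    -- This makes the exponent `l ^ 2 / 2 * (n * p)` equal to `γ ^ 2 * n / 64`, free of `p`; `γ ^ 2
    -- < 8 * p` is what gives `l ≤ 1 / 2`.
    set l := γ / √(32 * p) with hl
    have hl0 : 0 < l := by positivity
    have hl2 : l ^ 2 * (32 * p) = γ ^ 2 := by
      rw [hl, div_pow, Real.sq_sqrt (by positivity), div_mul_cancel₀ _ (by positivity)]
    have hl' : l ≤ 1 / 2 := by
      refine le_of_sq_le_sq ?_ (by norm_num)
      by_contra! h
      nlinarith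
    have hsub : {d | γ ^ 2 < 2 * transitionError (learned c s₀ β (d :: T)) P T.length s a ^ 2 * p} ⊆
        ⋃ B : Finset S, {d | 0 ≤ ∑ j, deviation P T.length s a B l (d j ⟨T.length, hT⟩)} := by
      intro d hd
      by_contra! h
      simp only [Set.mem_iUnion, Set.mem_ofPred_eq, not_exists, not_le] at h
      have h1 := transitionError_empirical_le (t := ⟨T.length, hT⟩) hs
        (learned_cons_self c s₀ β d T) hl0 h
      have h2 := transitionError_nonneg (learned c s₀ β (d :: T)) P T.length s a
      have h3 : transitionError (learned c s₀ β (d :: T)) P T.length s a ^ 2 ≤ (2 * l) ^ 2 :=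
        pow_le_pow_left₀ h2 h1 2
      have h4 := mul_le_mul_of_nonneg_right h3 hp0
      have hd : γ ^ 2 < 2 * transitionError (learned c s₀ β (d :: T)) P T.length s a ^ 2 * p := hd
      nlinarith [sq_nonneg γ]
    refine (MeasureTheory.measure_mono hsub).trans
      ((MeasureTheory.measure_iUnion_fintype_le _ _).trans ?_)
    refine (Finset.sum_le_card_nsmul _ _ (ENNReal.ofReal (Real.exp (-L))) fun B _ => ?_).trans_eq ?_
    · refine (phase_toOuterMeasure_deviation_le P c s₀ T ⟨T.length, hT⟩ rfl s a B hl0.le hl'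
        hn).trans (ENNReal.ofReal_le_ofReal (Real.exp_le_exp.2 (neg_le_neg (hL.trans_eq ?_))))
      rw [← hl2]
      ring
    · simp

theorem phase_not_phaseAccurate_le (P : Dynamics S A) (hc : c.Valid s₀ β)
    (hm : 2 * ((Fintype.card S : ℝ) * Fintype.card A) ≤ m) (hγ : 0 < γ) {L : ℝ}
    (hL : L ≤ γ ^ 2 * (m / (2 * (Fintype.card S * Fintype.card A))) / 64)
    {T : Transcript S A m H} (hT : T.length < H) :
    (phase P c s₀ T).toOuterMeasure {d | ¬ PhaseAccurate P c s₀ β γ T d} ≤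
      Fintype.card S * Fintype.card A * 2 ^ Fintype.card S * ENNReal.ofReal (Real.exp (-L)) := by
  classical
  have hsub : {d | ¬ PhaseAccurate P c s₀ β γ T d} ⊆ ⋃ g : S × A, {d | g.1 ∈ active c s₀ β T ∧
      γ ^ 2 < 2 * transitionError (learned c s₀ β (d :: T)) P T.length g.1 g.2 ^ 2 *
        occupancy P (det (c.plan T g.1)) s₀ T.length g.1} := by
    intro d hd
    simp only [PhaseAccurate, Set.mem_ofPred_eq, not_forall, not_le] at hd
    obtain ⟨s, hs, a, hd⟩ := hd
    exact Set.mem_iUnion.2 ⟨(s, a), hs, hd⟩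
  refine (MeasureTheory.measure_mono hsub).trans
    ((MeasureTheory.measure_iUnion_fintype_le _ _).trans ?_)
  refine (Finset.sum_le_card_nsmul _ _
    (2 ^ Fintype.card S * ENNReal.ofReal (Real.exp (-L))) fun g _ => ?_).trans_eq ?_
  · by_cases hg : g.1 ∈ active c s₀ β T
    · simp only [hg, true_and]
      exact phase_transitionError_le P hT hg g.2 hγ (hc.le_card_group hm hg g.2) hL
    · simp [hg]
  · simp [mul_assoc]

/-- Failure occurs either earlier or in the last phase. The latter has probability at most `η` given
any transcript, so adaptive choices do no harm. -/
theorem run_not_runAccurate_le {P : Dynamics S A} {η : ℝ≥0∞}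
    (hη : ∀ T : Transcript S A m H, T.length < H →
      (phase P c s₀ T).toOuterMeasure {d | ¬ PhaseAccurate P c s₀ β γ T d} ≤ η)
    {n : ℕ} (hn : n ≤ H) :
    (run P c s₀ n).toOuterMeasure {T | ¬ (T.length = n ∧ RunAccurate P c s₀ β γ T)} ≤ n * η := by
  induction n with
  | zero =>
    rw [run, PMF.toOuterMeasure_pure_apply, if_neg (by simp [RunAccurate])]
    exact zero_le
  | succ n ih =>
    have ih := ih (by omega)
    rw [run, PMF.toOuterMeasure_bind_apply]
    set bad := {T | ¬ (T.length = n ∧ RunAccurate P c s₀ β γ T)} with hbad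
    have h : ∀ T, run P c s₀ n T * ((phase P c s₀ T).map fun d => d :: T).toOuterMeasure
        {T | ¬ (T.length = n + 1 ∧ RunAccurate P c s₀ β γ T)} ≤
        bad.indicator (run P c s₀ n) T + run P c s₀ n T * η := by
      intro T
      rw [PMF.toOuterMeasure_map_apply]
      by_cases hT : T ∈ bad
      · rw [Set.indicator_of_mem hT]
        exact le_add_right (mul_le_of_le_one_right' (toOuterMeasure_le_one _ _))
      · rw [Set.indicator_of_notMem hT, zero_add]
        obtain ⟨hlen, hacc⟩ := not_not.1 hT
        refine mul_le_mul_right ((MeasureTheory.measure_mono fun d hd => ?_).trans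
          (hη T (by omega))) _
        exact fun hd' => hd ⟨by simp [hlen], hacc, hd'⟩
    refine (ENNReal.tsum_le_tsum h).trans ?_
    rw [ENNReal.tsum_add, ENNReal.tsum_mul_right, PMF.tsum_coe, ← PMF.toOuterMeasure_apply,
      Nat.cast_succ, add_mul]
    exact add_le_add_left ih _

end Algorithm

/-! ### Failure probability and the main theorem -/

theorem ofReal_one_sub_le_of_compl_le {Y : Type*} (p : PMF Y) {s : Set Y} {δ : ℝ}
    (h : p.toOuterMeasure sᶜ ≤ ENNReal.ofReal δ) (hδ : 0 ≤ δ) :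
    ENNReal.ofReal (1 - δ) ≤ p.toOuterMeasure s := by
  rw [ENNReal.ofReal_sub _ hδ, ENNReal.ofReal_one, tsub_le_iff_right]
  rw [← toOuterMeasure_univ p, ← Set.union_compl_self s]
  exact (MeasureTheory.measure_union_le _ _).trans (by gcongr)

theorem card_mul_exp_neg_le {x y n δ : ℝ} {k : ℕ} (hx : 0 < x) (hy : 0 < y) (hn : 0 < n)
    (hδ : 0 < δ) :
    n * (x * y * 2 ^ k * Real.exp (-(Real.log (x * n * y / δ) + k))) ≤ δ := by
  have h2 : (2 : ℝ) ^ k ≤ Real.exp k := by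
    rw [← Real.exp_one_pow]
    exact pow_le_pow_left₀ (by norm_num) (by linarith [Real.add_one_le_exp 1]) k
  rw [neg_add, Real.exp_add, Real.exp_neg, Real.exp_log (by positivity), Real.exp_neg]
  have h3 : n * (x * y * 2 ^ k * ((x * n * y / δ)⁻¹ * (Real.exp k)⁻¹)) =
      δ * (2 ^ k / Real.exp k) := by
    field_simp
  rw [h3]
  exact mul_le_of_le_one_right hδ.le (div_le_one_of_le₀ h2 (Real.exp_pos _).le)

end MARFE

theorem theorem1 :
    ∃ C : ℝ, 0 < C ∧
      ∀ (S A : Type*) [Fintype S] [Fintype A] [Nonempty A]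
        (H : ℕ) (_ : 1 ≤ H) (s₀ : S) (P : MARFE.Dynamics S A)
        (ε δ : ℝ) (_ : 0 < ε) (_ : ε < 1) (_ : 0 < δ) (_ : δ < 1)
        (m : ℕ)
        (_ : C * ((Fintype.card S : ℝ) ^ 5 * (H : ℝ) ^ 6 * (Fintype.card A : ℝ) *
            (Real.log ((Fintype.card S : ℝ) * H * Fintype.card A / δ) + Fintype.card S)) / ε ^ 2
          ≤ (m : ℝ))
        (c : MARFE.Choices S A m H)
        (_ : c.Valid s₀ (ε / (2 * (H : ℝ) ^ 2 * Fintype.card S))),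
        ENNReal.ofReal (1 - δ) ≤
          (MARFE.output P c s₀ (ε / (2 * (H : ℝ) ^ 2 * Fintype.card S))).toOuterMeasure
            {Phat | ∀ r : ℕ → S → A → ℝ, (∀ h < H, ∀ s a, r h s a ∈ Set.Icc (0 : ℝ) 1) →
              ∀ πhat : MARFE.Policy S A,
                (∀ π : MARFE.DetPolicy S A,
                  MARFE.sinkValue Phat r s₀ H (MARFE.det π) ≤
                    MARFE.sinkValue Phat r s₀ H πhat) →
                ∀ π : MARFE.Policy S A,
                  MARFE.value P r s₀ H π - MARFE.value P r s₀ H πhat ≤ ε} := by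
  -- `2048 = 16 * 2 * 64`: from `γ ^ 2 = ε ^ 2 / (16 * H ^ 6 * S ^ 4)`, groups of size at least `m /
  -- (2 * S * A)`, and the exponent `γ ^ 2 * n / 64`.
  refine ⟨2048, by norm_num, ?_⟩
  intro S A _ _ _ H hH s₀ P ε δ hε hε1 hδ hδ1 m hm c hc
  set β : ℝ := ε / (2 * (H : ℝ) ^ 2 * Fintype.card S) with hβ
  -- The largest value with `H * S * γ ≤ β / 2`.
  set γ : ℝ := ε / (4 * (H : ℝ) ^ 3 * Fintype.card S ^ 2) with hγ
  have hS1 : (1 : ℝ) ≤ Fintype.card S := Nat.one_le_cast.2 (Fintype.card_pos_iff.2 ⟨s₀⟩)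
  have hA1 : (1 : ℝ) ≤ Fintype.card A := Nat.one_le_cast.2 Fintype.card_pos
  have hH1 : (1 : ℝ) ≤ H := Nat.one_le_cast.2 hH
  set x : ℝ := (Fintype.card S : ℝ) with hx
  set y : ℝ := (Fintype.card A : ℝ) with hy
  set n : ℝ := (H : ℝ) with hn
  set L : ℝ := Real.log (x * n * y / δ) + x with hL
  have hx0 : 0 < x := by linarith
  have hy0 : 0 < y := by linarith
  have hn0 : 0 < n := by linarith
  have hγ0 : 0 < γ := by positivity
  have hβ0 : 0 < β := by positivity
  have hL1 : 1 ≤ L := by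
    have : 0 ≤ Real.log (x * n * y / δ) := by
      refine Real.log_nonneg ((one_le_div hδ).2 (hδ1.le.trans ?_))
      exact one_le_mul_of_one_le_of_one_le (one_le_mul_of_one_le_of_one_le hS1 hH1) hA1
    linarith
  have hm' : 2048 * (x ^ 5 * n ^ 6 * y * L) ≤ m * ε ^ 2 := (div_le_iff₀ (by positivity)).1 hm
  have hm2 : 2 * (x * y) ≤ m := by
    have h1 : x * y ≤ x ^ 5 * n ^ 6 * y * L := by
      calc x * y = x * 1 * y * 1 := by ring
        _ ≤ x ^ 5 * n ^ 6 * y * L := by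
          gcongr
          · exact le_self_pow₀ hS1 (by norm_num)
          · exact one_le_pow₀ hH1
    have h2 : (m : ℝ) * ε ^ 2 ≤ m :=
      mul_le_of_le_one_right (Nat.cast_nonneg m) (pow_le_one₀ hε.le hε1.le)
    nlinarith
  have hLm : L ≤ γ ^ 2 * (m / (2 * (x * y))) / 64 := by
    have h1 : γ ^ 2 * (m / (2 * (x * y))) / 64 = m * ε ^ 2 / (2048 * (x ^ 5 * n ^ 6 * y)) := by
      rw [hγ]
      field_simp
      ring
    rw [h1, le_div_iff₀ (by positivity)]
    linarith
  have hβγ : n * (x * γ) ≤ β / 2 := by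
    refine le_of_eq ?_
    rw [hγ, hβ]
    field_simp
    ring
  refine MARFE.ofReal_one_sub_le_of_compl_le _ ?_ hδ.le
  rw [MARFE.output, PMF.toOuterMeasure_map_apply]
  have hrun := MARFE.run_not_runAccurate_le (P := P) (γ := γ) (H := H)
    (fun T hT => MARFE.phase_not_phaseAccurate_le P hc hm2 hγ0 hLm hT) le_rfl
  refine (MeasureTheory.measure_mono fun T hT => ?_).trans (hrun.trans ?_)
  · rintro ⟨hlen, hacc⟩
    refine hT fun r hr πhat hopt π => ?_
    have hacc := hacc.isAccurate_learned hc
    rw [hlen] at hacc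
    refine (hacc.value_sub_value_le hγ0.le hβ0.le hβγ hr hopt π).trans ?_
    have h1 : n ^ 2 * (x * β) = ε / 2 := by
      rw [hβ]
      field_simp
    have h2 : n * (n * (x * γ)) ≤ n * (β / 2) := mul_le_mul_of_nonneg_left hβγ hn0.le
    have h3 : n * β ≤ n ^ 2 * (x * β) := by
      have : n * 1 * (1 * β) ≤ n * n * (x * β) := by gcongr
      linarith
    have h4 : n ^ 2 * (x * (2 * γ + β)) = 2 * (n * (n * (x * γ))) + n ^ 2 * (x * β) := by ring
    linarith
  · have hcard := MARFE.card_mul_exp_neg_le (k := Fintype.card S) hx0 hy0 hn0 hδ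
    refine le_trans (le_of_eq ?_) (ENNReal.ofReal_le_ofReal hcard)
    rw [ENNReal.ofReal_mul hn0.le, ENNReal.ofReal_mul (by positivity),
      ENNReal.ofReal_mul (by positivity), ENNReal.ofReal_mul hx0.le,
      ENNReal.ofReal_pow (by norm_num), hx, hy, hn]
    simp only [ENNReal.ofReal_natCast, ENNReal.ofReal_ofNat]
    rfl
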